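/- Let $\Gamma=\mathrm{SL}(2,\mathbb Z)$, and let $\Gamma\backslash\mathrm{SL}(2,\mathbb R)$ be the space of cosets $\Gamma g$ with the quotient topology. For $t\in\mathbb R$ let $a_t=\begin{pmatrix}e^{-t/2}&0\\0&e^{t/2}\end{pmatrix}$, acting on this space by right multiplication, and for $x\in\mathbb R$ let $\Gamma_x=\Gamma\begin{pmatrix}1&x\\0&1\end{pmatrix}$. A neighbourhood of the cusp is a subset of $\Gamma\backslash\mathrm{SL}(2,\mathbb R)$ whose complement is relatively compact. For such a neighbourhood $U$ and $T>0$ put $$I_T(U)=\frac1T\,\bigl|\{t\in[0,T]:\Gamma_xa_t\in U\}\bigr|,$$ where $|\cdot|$ is (outer) Lebesgue measure. The orbit $\{\Gamma_xa_t\}_{t\ge0}$ visits the cusp with frequency $0$ if $I_T(U)\to0$ as $T\to\infty$ for some neighbourhood $U$ of the cusp, and with frequency $1$ if $I_T(U)\to1$ as $T\to\infty$ for every neighbourhood $U$ of the cusp. Let $x$ be an irrational real number with classical (regular) continued fraction expansion $[a_0,a_1,a_2,\dots]$. For $\xi>1$ and $j\ge1$ let $a_j^\xi=a_j$ if $a_j>\xi$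 and $a_j^\xi=1$ if $a_j\le\xi$, and put $$A_N^\xi=\frac1N\sum_{j=1}^N\log a_j^\xi,\qquad A_N=\frac1N\sum_{j=1}^N\log a_j .$$ Then: 1. $\{\Gamma_xa_t\}_{t\ge0}$ visits the cusp with frequency $0$ if and only if $A_N^\xi\to0$ as $N\to\infty$ for some $\xi>1$. 2. $\{\Gamma_xa_t\}_{t\ge0}$ visits the cusp with frequency $1$ if and only if $A_N\to\infty$ as $N\to\infty$. If $x$ is rational (so that its continued fraction is finite), then $\{\Gamma_xa_t\}_{t\ge0}$ visits the cusp with frequency $1$, and not with frequency $0$. -/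

import Mathlib

open Filter Topology MeasureTheory
open scoped MatrixGroups

noncomputable section

/-- `Γ = SL(2, ℤ)`, as a subgroup of `SL(2, ℝ)`. -/
def integerSL2 : Subgroup SL(2, ℝ) :=
  (Matrix.SpecialLinearGroup.map (n := Fin 2) (Int.castRingHom ℝ)).range

/-- The homogeneous space `SL(2, ℤ) \ SL(2, ℝ)` of cosets `Γ g`, with the quotient topology. -/
abbrev ModularSpace : Type := Quotient (QuotientGroup.rightRel integerSL2)

/-- The coset `Γ g`. -/
def modularCoset (g : SL(2, ℝ)) : ModularSpace := Quotient.mk _ g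

/-- `a_t = diag (e^{-t/2}, e^{t/2})`. -/
def diagFlow (t : ℝ) : SL(2, ℝ) :=
  ⟨!![Real.exp (-t / 2), 0; 0, Real.exp (t / 2)], by
    rw [Matrix.det_fin_two_of, ← Real.exp_add]
    ring_nf
    simp⟩

/-- The unipotent matrix with rows `(1, x)` and `(0, 1)`. -/
def unipotent (x : ℝ) : SL(2, ℝ) :=
  ⟨!![1, x; 0, 1], by simp [Matrix.det_fin_two_of]⟩

/-- Right multiplication on the space of cosets: `(Γ g) h = Γ (g h)`. -/
def ModularSpace.rightMul (p : ModularSpace) (h : SL(2, ℝ)) : ModularSpace :=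
  Quotient.map (· * h) (fun a b hab => by
    have hab' : QuotientGroup.rightRel integerSL2 a b := hab
    change QuotientGroup.rightRel integerSL2 (a * h) (b * h)
    rw [QuotientGroup.rightRel_apply] at hab' ⊢
    simpa [mul_assoc] using hab') p

/-- The orbit `t ↦ Γ_x a_t`, where `Γ_x = Γ (1 x; 0 1)`. -/
def cuspOrbit (x t : ℝ) : ModularSpace :=
  (modularCoset (unipotent x)).rightMul (diagFlow t)

/-- Neighbourhoods of the cusp (the only end of the space): the sets whose complement is
relatively compact. -/
def IsCuspNhd (U : Set ModularSpace) : Prop := U ∈ cocompact ModularSpace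

/-- The proportion `I_T` of the time interval `[0, T]` that the orbit of `Γ_x` spends in `U`. -/
def visitProportion (x : ℝ) (U : Set ModularSpace) (T : ℝ) : ℝ :=
  (volume {t : ℝ | t ∈ Set.Icc 0 T ∧ cuspOrbit x t ∈ U}).toReal / T

def VisitsCuspWithFrequencyZero (x : ℝ) : Prop :=
  ∃ U : Set ModularSpace, IsCuspNhd U ∧ Tendsto (visitProportion x U) atTop (𝓝 0)

def VisitsCuspWithFrequencyOne (x : ℝ) : Prop :=
  ∀ U : Set ModularSpace, IsCuspNhd U → Tendsto (visitProportion x U) atTop (𝓝 1)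

/-- The partial quotients `a_0, a_1, …` of the classical continued fraction of `x`. The default
value `0` occurs only after the expansion has stopped, hence never for irrational `x`. -/
def partialQuotient (x : ℝ) : ℕ → ℝ
  | 0 => (GenContFract.of x).h
  | j + 1 => ((GenContFract.of x).partDens.get? j).getD 0

open Classical in
/-- `a_j^ξ`, which is `a_j` if `a_j > ξ` and `1` otherwise. -/
def modifiedPartialQuotient (x ξ : ℝ) (j : ℕ) : ℝ :=
  if ξ < partialQuotient x j then partialQuotient x j else 1

/-- `A_N = (1/N) ∑_{j=1}^N log a_j`. -/
def logAverage (x : ℝ) (N : ℕ) : ℝ :=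
  (1 / (N : ℝ)) * ∑ j ∈ Finset.Icc 1 N, Real.log (partialQuotient x j)

/-- `A_N^ξ = (1/N) ∑_{j=1}^N log a_j^ξ`. -/
def modifiedLogAverage (x ξ : ℝ) (N : ℕ) : ℝ :=
  (1 / (N : ℝ)) * ∑ j ∈ Finset.Icc 1 N, Real.log (modifiedPartialQuotient x ξ j)

end

/-! By Mahler's criterion the sets `shortVectorSet ε`, of lattices ℤ²g with a short nonzero vector,
are a base of neighbourhoods of the cusp (`isCuspNhd_shortVectorSet`,
`IsCuspNhd.exists_shortVectorSet_subset`). The lattice of Γ_x a_t consists of the vectors (m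
e^{-t/2}, (mx+n) e^{t/2}). Put τ_k = 2 log q_k. For τ_k ≤ t ≤ τ_{k+1} only multiples of the
convergent vector (q_k, -p_k) can be short, and that vector is short exactly on a window obtained
from the block by removing 2 log(1/ε) at each end, up to an error of 2 log 2
(`ConvergentData.mem_shortVectorSet_iff_time`). So a block of length ℓ_k = τ_{k+1} - τ_k = 2 log
a_{k+1} + O(1) contributes max(ℓ_k - C, 0) to the visit time, with C known up to 2 log 2.

Frequency 1: the time outside the cusp up to τ_N is comparable to N, at most C per block and at
least log 2 per block on average. Hence frequency 1 means τ_N / N → ∞, which is A_N → ∞.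

Frequency 0: for matched ε and ξ, only blocks with a_{k+1} > ξ matter, and the visit time is bounded
above and below in terms of N A_N^ξ. Upper and lower linear bounds on τ_N convert this into
proportions.

For rational x the vector (denominator, -numerator) is contracted to 0. -/

/-- The element of `SL(2, ℝ)` defined by an element of `SL(2, ℤ)`. -/
abbrev realSL2 (γ : SL(2, ℤ)) : SL(2, ℝ) :=
  Matrix.SpecialLinearGroup.map (n := Fin 2) (Int.castRingHom ℝ) γ

theorem modularCoset_eq_iff {g h : SL(2, ℝ)} :
    modularCoset g = modularCoset h ↔ ∃ γ : SL(2, ℤ), h = realSL2 γ * g := by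
  unfold modularCoset
  rw [Quotient.eq, QuotientGroup.rightRel_apply]
  constructor
  · rintro ⟨γ, hγ⟩
    exact ⟨γ, by rw [realSL2, hγ]; group⟩
  · rintro ⟨γ, rfl⟩
    exact ⟨γ, by simp⟩

/-! ### Short vectors and neighbourhoods of the cusp (Mahler's criterion). -/

/-- The lattice `ℤ² g` has a nonzero vector in the open square of half-side `ε`. -/
def HasShortVector (ε : ℝ) (g : SL(2, ℝ)) : Prop :=
  ∃ m n : ℤ, (m ≠ 0 ∨ n ≠ 0) ∧ |m * g 0 0 + n * g 1 0| < ε ∧ |m * g 0 1 + n * g 1 1| < ε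

theorem HasShortVector.of_realSL2_mul {ε : ℝ} {g : SL(2, ℝ)} {γ : SL(2, ℤ)}
    (h : HasShortVector ε (realSL2 γ * g)) : HasShortVector ε g := by
  obtain ⟨m, n, hmn, h0, h1⟩ := h
  refine ⟨m * γ 0 0 + n * γ 1 0, m * γ 0 1 + n * γ 1 1, ?_, ?_, ?_⟩
  · by_contra! hc
    have hdet := γ.det_coe
    rw [Matrix.det_fin_two] at hdet
    have hm : m = 0 := by
      linear_combination (γ 1 1) * hc.1 - (γ 1 0) * hc.2 - m * hdet
    have hn : n = 0 := by
      linear_combination (γ 0 0) * hc.2 - (γ 0 1) * hc.1 - n * hdet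
    rcases hmn with h | h <;> contradiction
  · simp only [Matrix.SpecialLinearGroup.coe_mul, Matrix.mul_apply, Fin.sum_univ_two] at h0
    convert h0 using 2
    simp
    ring
  · simp only [Matrix.SpecialLinearGroup.coe_mul, Matrix.mul_apply, Fin.sum_univ_two] at h1
    convert h1 using 2
    simp
    ring

/-- The set of lattices with a nonzero vector in the open square of half-side `ε`. -/
def shortVectorSet (ε : ℝ) : Set ModularSpace :=
  {p | ∃ g, modularCoset g = p ∧ HasShortVector ε g}

theorem modularCoset_mem_shortVectorSet {ε : ℝ} {g : SL(2, ℝ)} :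
    modularCoset g ∈ shortVectorSet ε ↔ HasShortVector ε g := by
  refine ⟨?_, fun h => ⟨g, rfl, h⟩⟩
  rintro ⟨h, hg, hs⟩
  obtain ⟨γ, rfl⟩ := modularCoset_eq_iff.1 hg.symm
  exact hs.of_realSL2_mul

theorem continuous_modularCoset : Continuous modularCoset := continuous_quot_mk

theorem continuous_entry (i j : Fin 2) : Continuous fun g : SL(2, ℝ) => g i j :=
  (continuous_apply_apply i j).comp continuous_subtype_val

theorem isCompact_entries_le (C : ℝ) : IsCompact {g : SL(2, ℝ) | ∀ i j, |g i j| ≤ C} := by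
  have hemb : IsClosedEmbedding (Subtype.val : SL(2, ℝ) → Matrix (Fin 2) (Fin 2) ℝ) :=
    (isClosed_eq (Continuous.matrix_det continuous_id) continuous_const).isClosedEmbedding_subtypeVal
  have hc : IsCompact {A : Matrix (Fin 2) (Fin 2) ℝ |
      ∀ i, A i ∈ {v : Fin 2 → ℝ | ∀ j, v j ∈ Set.Icc (-C) C}} :=
    isCompact_pi_infinite fun _ => isCompact_pi_infinite fun _ => isCompact_Icc
  have e : {g : SL(2, ℝ) | ∀ i j, |g i j| ≤ C} = Subtype.val ⁻¹'
      {A : Matrix (Fin 2) (Fin 2) ℝ | ∀ i, A i ∈ {v : Fin 2 → ℝ | ∀ j, v j ∈ Set.Icc (-C) C}} := by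
    ext g
    change (∀ i j, |g i j| ≤ C) ↔ ∀ i j, g i j ∈ Set.Icc (-C) C
    simp only [abs_le, Set.mem_Icc]
  rw [e]
  exact hemb.isCompact_preimage hc

/-- Reduction theory: move z = g·i into the standard fundamental domain. With bottom row (c, d), Im
z = 1/(c² + d²); this is bounded below in the domain, so the bottom row is bounded. The bottom row
is also a lattice vector, hence not short, which bounds Im z above and then the top row through a² +
b² = |z|²(c² + d²). -/
theorem exists_realSL2_mul_entries_le {ε : ℝ} (hε : 0 < ε) :
    ∃ C : ℝ, ∀ g : SL(2, ℝ), ¬ HasShortVector ε g →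
      ∃ γ : SL(2, ℤ), ∀ i j, |(realSL2 γ * g) i j| ≤ C := by
  refine ⟨2 + 2 * (1 + 1 / (ε ^ 2) ^ 2), fun g hg => ?_⟩
  obtain ⟨γ, hγ⟩ := ModularGroup.exists_smul_mem_fd (g • UpperHalfPlane.I)
  refine ⟨γ, ?_⟩
  have hns : ¬ HasShortVector ε (realSL2 γ * g) := fun h => hg h.of_realSL2_mul
  have hz : γ • (g • UpperHalfPlane.I) = (realSL2 γ * g) • UpperHalfPlane.I := by
    rw [mul_smul]; rfl
  rw [hz] at hγ
  generalize realSL2 γ * g = h at hγ hns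
  set a := h 0 0
  set b := h 0 1
  set c := h 1 0
  set d := h 1 1
  have hdet : a * d - b * c = 1 := by
    have := h.det_coe
    rwa [Matrix.det_fin_two] at this
  have hz : ((h • UpperHalfPlane.I : UpperHalfPlane) : ℂ) =
      (a * Complex.I + b) / (c * Complex.I + d) := by
    rw [UpperHalfPlane.coe_specialLinearGroup_apply]
    rfl
  set z := h • UpperHalfPlane.I
  have hN : 0 < c ^ 2 + d ^ 2 := by
    by_contra! hc
    have h1 : c = 0 := by nlinarith [sq_nonneg c, sq_nonneg d]
    have h2 : d = 0 := by nlinarith [sq_nonneg c, sq_nonneg d]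
    rw [h1, h2] at hdet
    simp at hdet
  have him : (z : ℂ).im = 1 / (c ^ 2 + d ^ 2) := by
    rw [hz, Complex.div_im]
    have hN' : c * c + d * d ≠ 0 := by nlinarith
    simp [Complex.normSq_apply, add_comm (d * d)]
    field_simp
    linear_combination hdet
  have hsq : Complex.normSq (z : ℂ) = (a ^ 2 + b ^ 2) / (c ^ 2 + d ^ 2) := by
    rw [hz, Complex.normSq_div]
    simp [Complex.normSq_apply]
    ring
  obtain ⟨h1, h2⟩ := hγ
  have hre : (z : ℂ).re ^ 2 ≤ 1 / 4 := by
    have : |(z : ℂ).re| ≤ 1 / 2 := h2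
    rw [← sq_abs]
    nlinarith [abs_nonneg (z : ℂ).re]
  have hns2 : Complex.normSq (z : ℂ) = (z : ℂ).re ^ 2 + (1 / (c ^ 2 + d ^ 2)) ^ 2 := by
    rw [Complex.normSq_apply, him]; ring
  have hlow : ε ^ 2 ≤ c ^ 2 + d ^ 2 := by
    by_contra! hc
    apply hns
    refine ⟨0, 1, by simp, ?_, ?_⟩
    · simpa using abs_lt_of_sq_lt_sq (by nlinarith [sq_nonneg d]) hε.le
    · simpa using abs_lt_of_sq_lt_sq (by nlinarith [sq_nonneg c]) hε.le
  have hup : c ^ 2 + d ^ 2 ≤ 2 := by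
    by_contra! hc
    have : 1 / (c ^ 2 + d ^ 2) < 1 / 2 := one_div_lt_one_div_of_lt (by norm_num) hc
    have h0 : 0 < 1 / (c ^ 2 + d ^ 2) := by positivity
    nlinarith
  have hab : a ^ 2 + b ^ 2 ≤ 2 * (1 + 1 / (ε ^ 2) ^ 2) := by
    have e1 : a ^ 2 + b ^ 2 = Complex.normSq (z : ℂ) * (c ^ 2 + d ^ 2) := by
      rw [hsq]; field_simp
    have e2 : (1 / (c ^ 2 + d ^ 2)) ^ 2 ≤ 1 / (ε ^ 2) ^ 2 := by
      rw [one_div, inv_pow, ← one_div]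
      gcongr
    have e3 : Complex.normSq (z : ℂ) ≤ 1 + 1 / (ε ^ 2) ^ 2 := by
      rw [hns2]; linarith
    rw [e1]
    nlinarith [Complex.normSq_nonneg (z : ℂ)]
  have key : ∀ {u C : ℝ}, 0 ≤ C → u ^ 2 ≤ C → |u| ≤ 1 + C := fun hC hu =>
    abs_le_of_sq_le_sq (by nlinarith) (by linarith)
  have hε2 : 0 ≤ 2 * (1 + 1 / (ε ^ 2) ^ 2) := by positivity
  have hA : |a| ≤ _ := key hε2 (by nlinarith [sq_nonneg b])
  have hB : |b| ≤ _ := key hε2 (by nlinarith [sq_nonneg a])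
  have hC : |c| ≤ 1 + 2 := key (by norm_num) (by nlinarith [sq_nonneg d])
  have hD : |d| ≤ 1 + 2 := key (by norm_num) (by nlinarith [sq_nonneg c])
  have hε3 : 0 ≤ 1 / (ε ^ 2) ^ 2 := by positivity
  intro i j
  fin_cases i <;> fin_cases j
  · exact hA.trans (by linarith)
  · exact hB.trans (by linarith)
  · exact hC.trans (by linarith)
  · exact hD.trans (by linarith)

theorem isCuspNhd_shortVectorSet {ε : ℝ} (hε : 0 < ε) : IsCuspNhd (shortVectorSet ε) := by
  obtain ⟨C, hC⟩ := exists_realSL2_mul_entries_le hε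
  refine mem_cocompact.2 ⟨_, (isCompact_entries_le C).image continuous_modularCoset, ?_⟩
  intro p hp
  by_contra hs
  apply hp
  obtain ⟨g, rfl⟩ : ∃ g, modularCoset g = p := Quotient.exists_rep p
  obtain ⟨γ, hγ⟩ := hC g fun h => hs (modularCoset_mem_shortVectorSet.2 h)
  exact ⟨_, hγ, (modularCoset_eq_iff.2 ⟨γ, rfl⟩).symm⟩

/-- Inverting g recovers the integers m, n from the coordinates u, v of the vector; each is smaller
than 2 · C · 1/(2C) = 1 in absolute value, hence 0. -/
theorem not_hasShortVector_of_entries_lt {C : ℝ} (hC : 0 < C) {g : SL(2, ℝ)}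
    (hg : ∀ i j, |g i j| < C) : ¬ HasShortVector (1 / (2 * C)) g := by
  rintro ⟨m, n, hmn, h0, h1⟩
  have hdet : g 0 0 * g 1 1 - g 0 1 * g 1 0 = 1 := by
    have := g.det_coe
    rwa [Matrix.det_fin_two] at this
  set u := m * g 0 0 + n * g 1 0 with hu
  set v := m * g 0 1 + n * g 1 1 with hv
  have bound : ∀ {r s : ℝ}, |r| < C → |s| < C → |u * r - v * s| < 1 := by
    intro r s hr hs
    have e1 : |u| * |r| ≤ 1 / (2 * C) * |r| := by gcongr
    have e2 : |v| * |s| ≤ 1 / (2 * C) * |s| := by gcongr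
    have e3 : 1 / (2 * C) * |r| < 1 / (2 * C) * C := by gcongr
    have e4 : 1 / (2 * C) * |s| < 1 / (2 * C) * C := by gcongr
    have e5 : 1 / (2 * C) * C = 1 / 2 := by field_simp
    calc |u * r - v * s| ≤ |u * r| + |v * s| := abs_sub _ _
      _ < 1 := by rw [abs_mul, abs_mul]; linarith
  have hm : |(m : ℝ)| < 1 := by
    have := bound (hg 1 1) (hg 1 0)
    convert this using 2
    rw [hu, hv]
    linear_combination (-m : ℝ) * hdet
  have hn : |(n : ℝ)| < 1 := by
    have := bound (hg 0 1) (hg 0 0)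
    rw [← abs_neg] at this
    convert this using 2
    rw [hu, hv]
    linear_combination (-n : ℝ) * hdet
  rw [← Int.cast_abs] at hm hn
  norm_cast at hm hn
  rw [Int.abs_lt_one_iff] at hm hn
  rcases hmn with h | h <;> contradiction

/-- The classes of matrices with entries below k + 1 form an increasing open cover, so one of them
contains the compact set outside which everything lies in U; such lattices have no very short
vector. -/
theorem IsCuspNhd.exists_shortVectorSet_subset {U : Set ModularSpace} (hU : IsCuspNhd U) :
    ∃ ε : ℝ, 0 < ε ∧ shortVectorSet ε ⊆ U := by
  obtain ⟨K, hK, hKU⟩ := mem_cocompact.1 hU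
  let O : ℕ → Set ModularSpace := fun k =>
    {p | ∃ g, modularCoset g = p ∧ ∀ i j, |g i j| < (k + 1 : ℝ)}
  have hO : ∀ k, IsOpen (O k) := by
    intro k
    have : modularCoset ⁻¹' (O k) =
        ⋃ γ : SL(2, ℤ), {g | ∀ i j, |(realSL2 γ * g) i j| < (k + 1 : ℝ)} := by
      ext g
      simp only [Set.mem_preimage, Set.mem_iUnion, Set.mem_ofPred_eq, O]
      constructor
      · rintro ⟨h, hg, hh⟩
        obtain ⟨γ, rfl⟩ := modularCoset_eq_iff.1 hg.symm
        exact ⟨γ, hh⟩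
      · rintro ⟨γ, hγ⟩
        exact ⟨_, (modularCoset_eq_iff.2 ⟨γ, rfl⟩).symm, hγ⟩
    refine isQuotientMap_quot_mk.isOpen_preimage.1 (?_ : IsOpen (modularCoset ⁻¹' (O k)))
    rw [this]
    refine isOpen_iUnion fun γ => ?_
    simp only [Set.ofPred_forall]
    refine isOpen_iInter_of_finite fun i => isOpen_iInter_of_finite fun j => ?_
    exact isOpen_lt ((continuous_entry i j).comp (continuous_const_mul _)).abs continuous_const
  have hmono : Monotone O := by
    rintro k l hkl p ⟨g, hg, hlt⟩
    exact ⟨g, hg, fun i j => (hlt i j).trans_le (by gcongr)⟩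
  have hcov : K ⊆ ⋃ k, O k := by
    intro p _
    obtain ⟨g, rfl⟩ : ∃ g, modularCoset g = p := Quotient.exists_rep p
    obtain ⟨k, hk⟩ := exists_nat_gt (∑ i, ∑ j, |g i j|)
    refine Set.mem_iUnion.2 ⟨k, g, rfl, fun i j => ?_⟩
    have h1 : |g i j| ≤ ∑ j, |g i j| :=
      Finset.single_le_sum (f := fun j => |g i j|) (fun _ _ => abs_nonneg _) (Finset.mem_univ j)
    have h2 : ∑ j, |g i j| ≤ ∑ i, ∑ j, |g i j| :=
      Finset.single_le_sum (f := fun i => ∑ j, |g i j|)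
        (fun _ _ => Finset.sum_nonneg fun _ _ => abs_nonneg _) (Finset.mem_univ i)
    linarith
  obtain ⟨k, hk⟩ := hK.elim_directed_cover O hO hcov hmono.directed_le
  refine ⟨1 / (2 * (k + 1)), by positivity, fun p hp => hKU fun hpK => ?_⟩
  obtain ⟨g, rfl, hg⟩ := hk hpK
  exact not_hasShortVector_of_entries_lt (by positivity) hg (modularCoset_mem_shortVectorSet.1 hp)

theorem cuspOrbit_mem_shortVectorSet {x t ε : ℝ} :
    cuspOrbit x t ∈ shortVectorSet ε ↔ ∃ m n : ℤ, (m ≠ 0 ∨ n ≠ 0) ∧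
      |(m : ℝ)| * Real.exp (-t / 2) < ε ∧ |m * x + n| * Real.exp (t / 2) < ε := by
  have : cuspOrbit x t = modularCoset (unipotent x * diagFlow t) := rfl
  rw [this, modularCoset_mem_shortVectorSet, HasShortVector]
  have e : ∀ m n : ℤ, (m : ℝ) * (x * Real.exp (t / 2)) + n * Real.exp (t / 2)
      = (m * x + n) * Real.exp (t / 2) := fun m n => by ring
  simp only [Matrix.SpecialLinearGroup.coe_mul, Matrix.mul_apply, Fin.sum_univ_two]
  simp [unipotent, diagFlow, abs_mul, e]

theorem shortVectorSet_mono {ε ε' : ℝ} (h : ε ≤ ε') : shortVectorSet ε ⊆ shortVectorSet ε' := by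
  rintro p ⟨g, hg, m, n, hmn, h0, h1⟩
  exact ⟨g, hg, m, n, hmn, h0.trans_le h, h1.trans_le h⟩

/-! ### Convergents and short vectors. -/

/-- The properties of the convergents `p k / q k` of the continued fraction with partial quotients
`a` that control the distance from the orbit of `x` to the cusp. -/
structure ConvergentData (x : ℝ) (a : ℕ → ℝ) (p q : ℕ → ℤ) : Prop where
  one_le_a : ∀ k, 1 ≤ a (k + 1)
  q_zero : q 0 = 1
  one_le_q : ∀ k, 1 ≤ q k
  le_q_succ : ∀ k, a (k + 1) * q k ≤ q (k + 1)
  q_succ_le : ∀ k, (q (k + 1) : ℝ) ≤ (a (k + 1) + 1) * q k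
  two_mul_le : ∀ k, 2 * q k ≤ q (k + 2)
  det : ∀ k, p k * q (k + 1) - q k * p (k + 1) = (-1) ^ (k + 1)
  error_le : ∀ k, |q k * x - p k| * q (k + 1) ≤ 1

theorem exists_convergentData {x : ℝ} (hx : Irrational x) :
    ∃ p q : ℕ → ℤ, ConvergentData x (partialQuotient x) p q := by
  have hnt : ∀ n, ¬ (GenContFract.of x).TerminatedAt n := fun n hn => by
    obtain ⟨r, hr⟩ := (GenContFract.terminates_iff_rat x).1 ⟨n, hn⟩
    exact hx ⟨r, hr.symm⟩
  -- Index shift: entry n of the stream is the partial quotient a_{n+1}.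
  have hs : ∀ n, ∃ z : ℤ, 1 ≤ z ∧ (GenContFract.of x).s.get? n = some ⟨1, (z : ℝ)⟩ ∧
      partialQuotient x (n + 1) = z := by
    intro n
    obtain ⟨gp, hgp⟩ := Option.ne_none_iff_exists'.1 (hnt n)
    obtain ⟨h1, z, hz⟩ := GenContFract.of_partNum_eq_one_and_exists_int_partDen_eq hgp
    have hpd := GenContFract.partDen_eq_s_b hgp
    have hle := GenContFract.of_one_le_get?_partDen hpd
    refine ⟨z, ?_, ?_, ?_⟩
    · rw [hz] at hle; exact_mod_cast hle
    · rw [hgp, ← h1, ← hz]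
    · simp [partialQuotient, hpd, hz]
  choose z hz1 hzs hzq using hs
  set g := GenContFract.of x with hg
  have hd0 : g.dens 0 = 1 := GenContFract.zeroth_den_eq_one
  have hd1 : g.dens 1 = z 0 := GenContFract.first_den_eq (hzs 0)
  have hn0 : g.nums 0 = g.h := GenContFract.zeroth_num_eq_h
  have hn1 : g.nums 1 = z 0 * g.h + 1 := by simpa using GenContFract.first_num_eq (hzs 0)
  have hd2 : ∀ n, g.dens (n + 2) = z (n + 1) * g.dens (n + 1) + g.dens n := fun n => by
    simpa using GenContFract.dens_recurrence (hzs (n + 1)) rfl rfl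
  have hn2 : ∀ n, g.nums (n + 2) = z (n + 1) * g.nums (n + 1) + g.nums n := fun n => by
    simpa using GenContFract.nums_recurrence (hzs (n + 1)) rfl rfl
  have hh : g.h = (⌊x⌋ : ℝ) := by simp [hg]
  -- Two consecutive convergents are carried along because the recurrence has order two.
  have hint : ∀ n, (∃ u v : ℤ, g.nums n = u ∧ g.dens n = v ∧ 1 ≤ v) ∧
      (∃ u v : ℤ, g.nums (n + 1) = u ∧ g.dens (n + 1) = v ∧ 1 ≤ v) := by
    intro n
    induction n with
    | zero =>
      exact ⟨⟨⌊x⌋, 1, by rw [hn0, hh], by simp [hd0], le_rfl⟩,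
        ⟨z 0 * ⌊x⌋ + 1, z 0, by simp [hn1, hh], by simp [hd1], hz1 0⟩⟩
    | succ n ih =>
      obtain ⟨⟨u, v, hu, hv, hv1⟩, ⟨u', v', hu', hv', hv1'⟩⟩ := ih
      refine ⟨⟨u', v', hu', hv', hv1'⟩, ⟨z (n + 1) * u' + u, z (n + 1) * v' + v, ?_, ?_, ?_⟩⟩
      · simp [hn2, hu, hu']
      · simp [hd2, hv, hv']
      · nlinarith [hz1 (n + 1)]
  choose p q hp hq hq1 using fun n => (hint n).1
  have hq0 : q 0 = 1 := by have := hq 0; rw [hd0] at this; exact_mod_cast this.symm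
  have hqd1 : q 1 = z 0 := by have := hq 1; rw [hd1] at this; exact_mod_cast this.symm
  have hq2 : ∀ n, q (n + 2) = z (n + 1) * q (n + 1) + q n := fun n => by
    have := hd2 n; rw [hq, hq, hq] at this; exact_mod_cast this
  have hmono : ∀ n, q n ≤ q (n + 1) := by
    intro n
    cases n with
    | zero => rw [hq0]; exact hq1 _
    | succ n => rw [hq2]; nlinarith [hz1 (n + 1), hq1 (n + 1), hq1 n]
  refine ⟨p, q, ⟨fun k => ?_, hq0, hq1, fun k => ?_, fun k => ?_, fun k => ?_, fun k => ?_,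
    fun k => ?_⟩⟩
  · rw [hzq]; exact_mod_cast hz1 k
  · rw [hzq]
    cases k with
    | zero => simp [hq0, hqd1]
    | succ n => rw [hq2]; norm_cast; linarith [hq1 n]
  · rw [hzq]
    cases k with
    | zero => simp [hq0, hqd1]
    | succ n => rw [hq2]; norm_cast; linarith [hmono n]
  · rw [hq2]; nlinarith [hz1 (k + 1), hq1 (k + 1), hmono k]
  · have := SimpContFract.determinant (s := SimpContFract.of x) (n := k) (hnt k)
    change g.nums k * g.dens (k + 1) - g.dens k * g.nums (k + 1) = (-1) ^ (k + 1) at this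
    rw [hp, hp, hq, hq] at this
    exact_mod_cast this
  · have := GenContFract.abs_sub_convs_le (hnt k)
    rw [← hg, GenContFract.conv_eq_num_div_den, hp, hq, hq] at this
    have h1 : (0 : ℝ) < q k := by exact_mod_cast hq1 k
    have h2 : (0 : ℝ) < q (k + 1) := by exact_mod_cast hq1 (k + 1)
    have e : (q k * x - p k : ℝ) = q k * (x - p k / q k) := by field_simp
    rw [e, abs_mul, abs_of_pos h1]
    calc (q k : ℝ) * |x - p k / q k| * q (k + 1)
        ≤ q k * (1 / (q k * q (k + 1))) * q (k + 1) := by gcongr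
      _ = 1 := by field_simp

namespace ConvergentData

variable {x : ℝ} {a : ℕ → ℝ} {p q : ℕ → ℤ}

theorem q_pos (h : ConvergentData x a p q) (k : ℕ) : (0 : ℝ) < q k := by
  exact_mod_cast h.one_le_q k

/-- The determinant identity gives 1 ≤ q_k |e_{k+1}| + q_{k+1} |e_k|, where e_k = q_k x - p_k, and
the first term is at most 1/2 since |e_{k+1}| ≤ 1/q_{k+2} ≤ 1/(2 q_k). -/
theorem one_le_two_mul_error (h : ConvergentData x a p q) (k : ℕ) :
    1 ≤ 2 * (|q k * x - p k| * q (k + 1)) := by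
  have h0 := h.q_pos k
  have h1 := h.q_pos (k + 1)
  have hd : |(p k * q (k + 1) - q k * p (k + 1) : ℝ)| = 1 := by
    have : (p k * q (k + 1) - q k * p (k + 1) : ℝ) = (-1) ^ (k + 1) := by exact_mod_cast h.det k
    rw [this, abs_pow]; simp
  have e : (p k * q (k + 1) - q k * p (k + 1) : ℝ)
      = q k * (q (k + 1) * x - p (k + 1)) - q (k + 1) * (q k * x - p k) := by ring
  have h2 : (1 : ℝ) ≤ q k * |q (k + 1) * x - p (k + 1)| + q (k + 1) * |q k * x - p k| := by
    rw [← hd, e]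
    refine (abs_sub _ _).trans_eq ?_
    rw [abs_mul, abs_mul, abs_of_pos h0, abs_of_pos h1]
  have h3 := h.error_le (k + 1)
  have h4 : (2 * q k : ℝ) ≤ q (k + 2) := by exact_mod_cast h.two_mul_le k
  have h5 : |q (k + 1) * x - p (k + 1)| * (2 * q k) ≤ |q (k + 1) * x - p (k + 1)| * q (k + 2) := by
    gcongr
  linarith

theorem error_pos (h : ConvergentData x a p q) (k : ℕ) : 0 < |q k * x - p k| := by
  have := h.one_le_two_mul_error k
  have h1 := h.q_pos (k + 1)
  by_contra! hc
  nlinarith [abs_nonneg (q k * x - p k)]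

/-- A lattice vector that is short at a time between `2 log (q k)` and `2 log (q (k + 1))` is a
multiple of the `k`-th convergent vector. -/
theorem mem_shortVectorSet_iff (h : ConvergentData x a p q) {ε t : ℝ} (hε : ε ≤ 1 / 2) {k : ℕ}
    (h1 : q k ≤ Real.exp (t / 2)) (h2 : Real.exp (t / 2) ≤ q (k + 1)) :
    cuspOrbit x t ∈ shortVectorSet ε ↔
      q k < ε * Real.exp (t / 2) ∧ |q k * x - p k| * Real.exp (t / 2) < ε := by
  rw [cuspOrbit_mem_shortVectorSet]
  set E := Real.exp (t / 2) with hE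
  have hEpos : 0 < E := Real.exp_pos _
  have hneg : Real.exp (-t / 2) = E⁻¹ := by rw [hE, ← Real.exp_neg]; congr 1; ring
  have hq := h.q_pos k
  rw [hneg]
  constructor
  · rintro ⟨m, n, hmn, hm, hn⟩
    rw [mul_inv_lt_iff₀ hEpos] at hm
    -- Up to sign this is the determinant of the short vector against the convergent vector: an
    -- integer of absolute value below 1/2 + 1/2. This is where ε ≤ 1/2 enters.
    have hdet : m * p k + n * q k = 0 := by
      have e : (m * p k + n * q k : ℝ) = q k * (m * x + n) - m * (q k * x - p k) := by ring
      have b1 : q k * |m * x + n| < 1 / 2 := by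
        calc q k * |m * x + n| ≤ E * |m * x + n| := by gcongr
          _ < 1 / 2 := by linarith
      have b2 : |(m : ℝ)| * |q k * x - p k| ≤ 1 / 2 := by
        have he := h.error_le k
        calc |(m : ℝ)| * |q k * x - p k| ≤ (1 / 2 * q (k + 1)) * |q k * x - p k| := by
              gcongr
              refine hm.le.trans ?_
              gcongr
          _ ≤ 1 / 2 := by linarith
      have b : |(m * p k + n * q k : ℝ)| < 1 := by
        rw [e]
        refine (abs_sub _ _).trans_lt ?_
        rw [abs_mul, abs_mul, abs_of_pos hq]
        linarith
      have : |m * p k + n * q k| < 1 := by exact_mod_cast b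
      exact Int.abs_lt_one_iff.1 this
    have hcop : IsCoprime (q k) (p k) := by
      rcases Int.isUnit_iff.1 (isUnit_neg_one.pow (k + 1) : IsUnit ((-1 : ℤ) ^ (k + 1)))
        with hu | hu
      · exact ⟨-p (k + 1), q (k + 1), by have := h.det k; rw [hu] at this; linarith⟩
      · exact ⟨p (k + 1), -q (k + 1), by have := h.det k; rw [hu] at this; linarith⟩
    obtain ⟨c, hc⟩ : q k ∣ m := hcop.dvd_of_dvd_mul_right ⟨-n, by linarith⟩
    have hq0 : q k ≠ 0 := by have := h.one_le_q k; omega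
    have hnc : n = -(c * p k) := by
      have : q k * n = q k * (-(c * p k)) := by rw [hc] at hdet; linarith
      exact mul_left_cancel₀ hq0 this
    have hc0 : c ≠ 0 := by
      rintro rfl
      simp at hc hnc
      rcases hmn with h | h <;> contradiction
    -- The short vector is c times the convergent vector with |c| ≥ 1, so the convergent vector is
    -- at least as short.
    have hc1 : (1 : ℝ) ≤ |(c : ℝ)| := by exact_mod_cast Int.one_le_abs hc0
    constructor
    · refine lt_of_le_of_lt ?_ hm
      rw [hc]; push_cast
      rw [abs_mul, abs_of_pos hq]
      nlinarith
    · refine lt_of_le_of_lt ?_ hn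
      have : (m * x + n : ℝ) = c * (q k * x - p k) := by rw [hc, hnc]; push_cast; ring
      rw [this, abs_mul]
      have : 1 * |q k * x - p k| ≤ |(c : ℝ)| * |q k * x - p k| := by gcongr
      nlinarith
  · rintro ⟨h3, h4⟩
    refine ⟨q k, -p k, Or.inl (by have := h.one_le_q k; omega), ?_, ?_⟩
    · rwa [mul_inv_lt_iff₀ hEpos, abs_of_pos hq]
    · push_cast; rwa [← sub_eq_add_neg]

end ConvergentData

/-! ### Visit time, block by block. -/

/-- The time that the orbit of `Γ_x` spends in `U` up to time `T`. -/
noncomputable def visitTime (x : ℝ) (U : Set ModularSpace) (T : ℝ) : ℝ :=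
  volume.real {t : ℝ | t ∈ Set.Icc 0 T ∧ cuspOrbit x t ∈ U}

theorem visitProportion_eq (x : ℝ) (U : Set ModularSpace) (T : ℝ) :
    visitProportion x U T = visitTime x U T / T := rfl

theorem visitTime_nonneg (x : ℝ) (U : Set ModularSpace) (T : ℝ) : 0 ≤ visitTime x U T :=
  measureReal_nonneg

theorem volume_visits_ne_top (x : ℝ) (U : Set ModularSpace) (T : ℝ) :
    volume {t : ℝ | t ∈ Set.Icc 0 T ∧ cuspOrbit x t ∈ U} ≠ ⊤ :=
  ((measure_mono fun _ h => h.1).trans_lt (measure_Icc_lt_top (a := (0 : ℝ)) (b := T))).ne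

theorem visitTime_le (x : ℝ) (U : Set ModularSpace) {T : ℝ} (hT : 0 ≤ T) :
    visitTime x U T ≤ T := by
  have : visitTime x U T ≤ volume.real (Set.Icc 0 T) :=
    measureReal_mono (fun _ h => h.1) (by simp)
  simpa [hT] using this

theorem visitTime_mono_set (x : ℝ) {U U' : Set ModularSpace} (h : U ⊆ U') (T : ℝ) :
    visitTime x U T ≤ visitTime x U' T :=
  measureReal_mono (fun _ ht => ⟨ht.1, h ht.2⟩) (volume_visits_ne_top x U' T)

theorem visitTime_mono (x : ℝ) (U : Set ModularSpace) : Monotone (visitTime x U) :=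
  fun _ T' h => measureReal_mono (fun _ ht => ⟨⟨ht.1.1, ht.1.2.trans h⟩, ht.2⟩)
    (volume_visits_ne_top x U T')

theorem visitTime_le_add (x : ℝ) (U : Set ModularSpace) {T T' : ℝ} (h : T ≤ T') :
    visitTime x U T' ≤ visitTime x U T + (T' - T) := by
  have hsub : {t : ℝ | t ∈ Set.Icc 0 T' ∧ cuspOrbit x t ∈ U} ⊆
      {t : ℝ | t ∈ Set.Icc 0 T ∧ cuspOrbit x t ∈ U} ∪ Set.Icc T T' := by
    rintro t ⟨ht, hu⟩
    rcases le_total t T with h1 | h1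
    · exact Or.inl ⟨⟨ht.1, h1⟩, hu⟩
    · exact Or.inr ⟨h1, ht.2⟩
  have h1 := measureReal_mono hsub
    (measure_union_ne_top (volume_visits_ne_top x U T) (by simp))
  have h2 := measureReal_union_le (μ := volume)
    {t : ℝ | t ∈ Set.Icc 0 T ∧ cuspOrbit x t ∈ U} (Set.Icc T T')
  have h3 : volume.real (Set.Icc T T') = T' - T := by simp [h]
  rw [h3] at h2
  exact h1.trans h2

/-- The time `2 log (q k)` at which the `k`-th convergent vector becomes the relevant one. -/
noncomputable def denTime (q : ℕ → ℤ) (k : ℕ) : ℝ := 2 * Real.log (q k)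

namespace ConvergentData

variable {x : ℝ} {a : ℕ → ℝ} {p q : ℕ → ℤ}

theorem denTime_zero (h : ConvergentData x a p q) : denTime q 0 = 0 := by
  simp [denTime, h.q_zero]

theorem two_log_le_denTime_sub (h : ConvergentData x a p q) (k : ℕ) :
    2 * Real.log (a (k + 1)) ≤ denTime q (k + 1) - denTime q k := by
  have ha : 0 < a (k + 1) := by linarith [h.one_le_a k]
  have := Real.log_le_log (mul_pos ha (h.q_pos k)) (h.le_q_succ k)
  rw [Real.log_mul ha.ne' (h.q_pos k).ne'] at this
  simp only [denTime]
  linarith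

theorem denTime_sub_le_two_log (h : ConvergentData x a p q) (k : ℕ) :
    denTime q (k + 1) - denTime q k ≤ 2 * Real.log (a (k + 1) + 1) := by
  have ha : 0 < a (k + 1) + 1 := by linarith [h.one_le_a k]
  have := Real.log_le_log (h.q_pos (k + 1)) (h.q_succ_le k)
  rw [Real.log_mul ha.ne' (h.q_pos k).ne'] at this
  simp only [denTime]
  linarith

theorem denTime_mono (h : ConvergentData x a p q) : Monotone (denTime q) :=
  monotone_nat_of_le_succ fun k => by
    linarith [h.two_log_le_denTime_sub k, Real.log_nonneg (h.one_le_a k)]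

theorem denTime_nonneg (h : ConvergentData x a p q) (k : ℕ) : 0 ≤ denTime q k :=
  h.denTime_zero ▸ h.denTime_mono (Nat.zero_le k)

theorem two_log_two_le_denTime_sub (h : ConvergentData x a p q) (k : ℕ) :
    2 * Real.log 2 ≤ denTime q (k + 2) - denTime q k := by
  have h2 : (2 * q k : ℝ) ≤ q (k + 2) := by exact_mod_cast h.two_mul_le k
  have := Real.log_le_log (mul_pos two_pos (h.q_pos k)) h2
  rw [Real.log_mul two_ne_zero (h.q_pos k).ne'] at this
  simp only [denTime]
  linarith

/-- The time at which the second coordinate of the k-th convergent vector grows to 1 is the end of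
the k-th block, up to 2 log 2. -/
theorem log_error_bounds (h : ConvergentData x a p q) (k : ℕ) :
    denTime q (k + 1) ≤ -2 * Real.log |q k * x - p k| ∧
      -2 * Real.log |q k * x - p k| ≤ denTime q (k + 1) + 2 * Real.log 2 := by
  have he := h.error_pos k
  have hq := h.q_pos (k + 1)
  have h1 := Real.log_le_log (mul_pos he hq) (h.error_le k)
  have h2 := Real.log_le_log one_pos (h.one_le_two_mul_error k)
  rw [Real.log_mul two_ne_zero (mul_pos he hq).ne'] at h2
  rw [Real.log_mul he.ne' hq.ne', Real.log_one] at h1 h2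
  simp only [denTime]
  constructor <;> linarith

theorem mem_shortVectorSet_iff_time (h : ConvergentData x a p q) {ε t : ℝ} (hε0 : 0 < ε)
    (hε : ε ≤ 1 / 2) {k : ℕ} (h1 : denTime q k ≤ t) (h2 : t ≤ denTime q (k + 1)) :
    cuspOrbit x t ∈ shortVectorSet ε ↔ denTime q k + -2 * Real.log ε < t ∧
      t < -2 * Real.log |q k * x - p k| - -2 * Real.log ε := by
  simp only [denTime] at h1 h2 ⊢
  have hq := h.q_pos k
  have he := h.error_pos k
  rw [h.mem_shortVectorSet_iff hε ((Real.log_le_iff_le_exp hq).1 (by linarith))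
    ((Real.le_log_iff_exp_le (h.q_pos (k + 1))).1 (by linarith)),
    ← Real.log_lt_log_iff hq (by positivity), ← Real.log_lt_log_iff (by positivity) hε0,
    Real.log_mul hε0.ne' (Real.exp_pos _).ne', Real.log_mul he.ne' (Real.exp_pos _).ne',
    Real.log_exp]
  constructor <;> rintro ⟨h3, h4⟩ <;> constructor <;> linarith

/-- Each summand bounds the length of the whole window of shortness, whose end exceeds τ_{k+1} - 2
log(1/ε) by at most 2 log 2. -/
theorem visitTime_denTime_le (h : ConvergentData x a p q) {ε : ℝ} (hε0 : 0 < ε)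
    (hε : ε ≤ 1 / 2) (N : ℕ) :
    visitTime x (shortVectorSet ε) (denTime q N) ≤ ∑ k ∈ Finset.range N,
      max (denTime q (k + 1) - denTime q k - (-4 * Real.log ε - 2 * Real.log 2)) 0 := by
  induction N with
  | zero =>
    rw [h.denTime_zero]
    simpa using visitTime_le x (shortVectorSet ε) le_rfl
  | succ N ih =>
    rw [Finset.sum_range_succ]
    set A := denTime q N + -2 * Real.log ε
    set B := -2 * Real.log |q N * x - p N| - -2 * Real.log ε
    have hsub : {t : ℝ | t ∈ Set.Icc 0 (denTime q (N + 1)) ∧ cuspOrbit x t ∈ shortVectorSet ε} ⊆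
        {t : ℝ | t ∈ Set.Icc 0 (denTime q N) ∧ cuspOrbit x t ∈ shortVectorSet ε} ∪
          Set.Ioo A B := by
      rintro t ⟨ht, hu⟩
      rcases le_total t (denTime q N) with h1 | h1
      · exact Or.inl ⟨⟨ht.1, h1⟩, hu⟩
      · exact Or.inr ((h.mem_shortVectorSet_iff_time hε0 hε h1 ht.2).1 hu)
    have h1 := measureReal_mono hsub
      (measure_union_ne_top (volume_visits_ne_top x _ _) (by simp))
    have h2 := measureReal_union_le (μ := volume)
      {t : ℝ | t ∈ Set.Icc 0 (denTime q N) ∧ cuspOrbit x t ∈ shortVectorSet ε} (Set.Ioo A B)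
    have h3 : volume.real (Set.Ioo A B) = max (B - A) 0 := by
      simp [Measure.real, ENNReal.toReal_ofReal']
    have h4 : max (B - A) 0 ≤
        max (denTime q (N + 1) - denTime q N - (-4 * Real.log ε - 2 * Real.log 2)) 0 :=
      max_le_max_right _ (by have := (h.log_error_bounds N).2; simp only [A, B]; linarith)
    rw [h3] at h2
    exact (h1.trans h2).trans (add_le_add ih h4)

theorem le_visitTime_denTime (h : ConvergentData x a p q) {ε : ℝ} (hε0 : 0 < ε)
    (hε : ε ≤ 1 / 2) (N : ℕ) :
    ∑ k ∈ Finset.range N, max (denTime q (k + 1) - denTime q k - -4 * Real.log ε) 0 ≤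
      visitTime x (shortVectorSet ε) (denTime q N) := by
  induction N with
  | zero => simpa using visitTime_nonneg x (shortVectorSet ε) _
  | succ N ih =>
    rw [Finset.sum_range_succ]
    have hlog : Real.log ε ≤ 0 := Real.log_nonpos hε0.le (by linarith)
    set A := denTime q N + -2 * Real.log ε with hA
    set B := denTime q (N + 1) - -2 * Real.log ε with hB
    have hAB : ∀ t ∈ Set.Ioo A B, denTime q N < t ∧ t ≤ denTime q (N + 1) := by
      rintro t ⟨h1, h2⟩
      constructor <;> linarith
    have hsub : {t : ℝ | t ∈ Set.Icc 0 (denTime q N) ∧ cuspOrbit x t ∈ shortVectorSet ε} ∪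
        Set.Ioo A B ⊆
        {t : ℝ | t ∈ Set.Icc 0 (denTime q (N + 1)) ∧ cuspOrbit x t ∈ shortVectorSet ε} := by
      rintro t (⟨ht, hu⟩ | ht)
      · exact ⟨⟨ht.1, ht.2.trans (h.denTime_mono N.le_succ)⟩, hu⟩
      · obtain ⟨h1, h2⟩ := hAB t ht
        refine ⟨⟨(h.denTime_nonneg N).trans h1.le, h2⟩, ?_⟩
        rw [h.mem_shortVectorSet_iff_time hε0 hε h1.le h2]
        exact ⟨ht.1, ht.2.trans_le (by linarith [(h.log_error_bounds N).1])⟩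
    have hdisj : Disjoint {t : ℝ | t ∈ Set.Icc 0 (denTime q N) ∧ cuspOrbit x t ∈ shortVectorSet ε}
        (Set.Ioo A B) :=
      Set.disjoint_left.2 fun t ht ht' => absurd ht.1.2 (not_le.2 (hAB t ht').1)
    have h1 := measureReal_mono hsub (volume_visits_ne_top x _ _)
    -- Additivity needs only the interval to be measurable, so the outer measure of the visit set
    -- suffices.
    rw [measureReal_union hdisj measurableSet_Ioo (volume_visits_ne_top x _ _) (by simp)] at h1
    have h3 : volume.real (Set.Ioo A B) = max (B - A) 0 := by
      simp [Measure.real, ENNReal.toReal_ofReal']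
    have h4 : max (denTime q (N + 1) - denTime q N - -4 * Real.log ε) 0 = max (B - A) 0 := by
      congr 1; rw [hA, hB]; ring
    rw [h4, ← h3]
    exact (add_le_add_left ih _).trans h1

end ConvergentData

/-! ### From visit times to frequencies. -/

theorem visitProportion_le_one (x : ℝ) (U : Set ModularSpace) {T : ℝ} (hT : 0 < T) :
    visitProportion x U T ≤ 1 := by
  rw [visitProportion_eq, div_le_one hT]
  exact visitTime_le x U hT.le

theorem visitProportion_mono_set (x : ℝ) {U U' : Set ModularSpace} (h : U ⊆ U') {T : ℝ}
    (hT : 0 < T) : visitProportion x U T ≤ visitProportion x U' T := by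
  rw [visitProportion_eq, visitProportion_eq]
  have := visitTime_mono_set x h T
  gcongr

theorem visitsCuspWithFrequencyZero_iff (x : ℝ) :
    VisitsCuspWithFrequencyZero x ↔ ∃ ε : ℝ, 0 < ε ∧ ε ≤ 1 / 2 ∧
      Tendsto (visitProportion x (shortVectorSet ε)) atTop (𝓝 0) := by
  constructor
  · rintro ⟨U, hU, hlim⟩
    obtain ⟨ε, hε, hsub⟩ := hU.exists_shortVectorSet_subset
    refine ⟨min ε (1 / 2), by positivity, min_le_right _ _, ?_⟩
    refine tendsto_of_tendsto_of_tendsto_of_le_of_le' tendsto_const_nhds hlim ?_ ?_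
    · filter_upwards [eventually_gt_atTop 0] with T hT
      exact div_nonneg (visitTime_nonneg _ _ _) hT.le
    · filter_upwards [eventually_gt_atTop 0] with T hT
      exact visitProportion_mono_set x ((shortVectorSet_mono (min_le_left _ _)).trans hsub) hT
  · rintro ⟨ε, hε, -, hlim⟩
    exact ⟨_, isCuspNhd_shortVectorSet hε, hlim⟩

theorem visitsCuspWithFrequencyOne_iff (x : ℝ) :
    VisitsCuspWithFrequencyOne x ↔ ∀ ε : ℝ, 0 < ε → ε ≤ 1 / 2 →
      Tendsto (visitProportion x (shortVectorSet ε)) atTop (𝓝 1) := by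
  constructor
  · exact fun h ε hε _ => h _ (isCuspNhd_shortVectorSet hε)
  · intro h U hU
    obtain ⟨ε, hε, hsub⟩ := hU.exists_shortVectorSet_subset
    refine tendsto_of_tendsto_of_tendsto_of_le_of_le'
      (h (min ε (1 / 2)) (by positivity) (min_le_right _ _)) tendsto_const_nhds ?_ ?_
    · filter_upwards [eventually_gt_atTop 0] with T hT
      exact visitProportion_mono_set x ((shortVectorSet_mono (min_le_left _ _)).trans hsub) hT
    · filter_upwards [eventually_gt_atTop 0] with T hT
      exact visitProportion_le_one x U hT

/-- A function of a real variable tends to zero if it is controlled on the blocks between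
consecutive terms of a sequence tending to infinity. -/
theorem tendsto_zero_of_le_on_blocks {f : ℝ → ℝ} {g l : ℕ → ℝ} (hl : Tendsto l atTop atTop)
    (hf : ∀ᶠ T in atTop, 0 ≤ f T) (hg : Tendsto g atTop (𝓝 0))
    (hfg : ∀ᶠ N in atTop, ∀ T, l N ≤ T → T ≤ l (N + 1) → f T ≤ g N) :
    Tendsto f atTop (𝓝 0) := by
  rw [tendsto_order]
  refine ⟨fun b hb => hf.mono fun T hT => hb.trans_le hT, fun δ hδ => ?_⟩
  obtain ⟨N₀, hN₀⟩ := eventually_atTop.1 (hfg.and (hg.eventually_lt_const hδ))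
  filter_upwards [eventually_ge_atTop (l N₀)] with T hT
  have hex : ∃ j, T < l (N₀ + j) := by
    obtain ⟨K, hK⟩ := eventually_atTop.1 (hl.eventually_gt_atTop T)
    exact ⟨K, hK _ (Nat.le_add_left _ _)⟩
  classical
  -- The first index beyond N₀ at which l exceeds T locates a block containing T, without
  -- monotonicity of l.
  have hspec := Nat.find_spec hex
  obtain ⟨i, hi⟩ : ∃ i, Nat.find hex = i + 1 := Nat.exists_eq_succ_of_ne_zero fun h0 => by
    rw [h0] at hspec
    exact absurd hT (not_le.2 hspec)
  have hmin := Nat.find_min hex (m := i) (by omega)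
  rw [hi] at hspec
  obtain ⟨h1, h2⟩ := hN₀ (N₀ + i) (Nat.le_add_right _ _)
  exact (h1 T (not_lt.1 hmin) hspec.le).trans_lt h2

theorem sum_Icc_one_eq_sum_range (f : ℕ → ℝ) (N : ℕ) :
    ∑ j ∈ Finset.Icc 1 N, f j = ∑ k ∈ Finset.range N, f (k + 1) := by
  induction N with
  | zero => simp
  | succ N ih => rw [Finset.sum_Icc_succ_top (by omega), ih, Finset.sum_range_succ]

theorem natCast_mul_logAverage (x : ℝ) (N : ℕ) :
    N * logAverage x N = ∑ k ∈ Finset.range N, Real.log (partialQuotient x (k + 1)) := by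
  rcases N.eq_zero_or_pos with rfl | hN
  · simp
  · rw [logAverage, sum_Icc_one_eq_sum_range]
    field_simp

theorem natCast_mul_modifiedLogAverage (x ξ : ℝ) (N : ℕ) :
    N * modifiedLogAverage x ξ N =
      ∑ k ∈ Finset.range N, Real.log (modifiedPartialQuotient x ξ (k + 1)) := by
  rcases N.eq_zero_or_pos with rfl | hN
  · simp
  · rw [modifiedLogAverage, sum_Icc_one_eq_sum_range]
    field_simp

theorem log_add_one_le {u : ℝ} (hu : 1 ≤ u) : Real.log (u + 1) ≤ Real.log u + Real.log 2 := by
  rw [← Real.log_mul (by positivity) two_ne_zero]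
  exact Real.log_le_log (by positivity) (by linarith)

/-! ### Frequencies and averages of log a_j. -/

namespace ConvergentData

variable {x : ℝ} {a : ℕ → ℝ} {p q : ℕ → ℤ}

theorem sum_denTime_sub (h : ConvergentData x a p q) (N : ℕ) :
    ∑ k ∈ Finset.range N, (denTime q (k + 1) - denTime q k) = denTime q N := by
  rw [Finset.sum_range_sub, h.denTime_zero, sub_zero]

/-- Two consecutive blocks have total length at least 2 log 2, and truncation at M ≥ 2 log 2
preserves this; a single block may have length 0. Hence induction in steps of two, and N - 1 to
allow for parity. This forces a linear amount of time outside the cusp. -/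
theorem le_sum_min (h : ConvergentData x a p q) {M : ℝ} (hM : 2 * Real.log 2 ≤ M) (N : ℕ) :
    (N - 1) * Real.log 2 ≤
      ∑ k ∈ Finset.range N, min (denTime q (k + 1) - denTime q k) M := by
  have hlog : 0 < Real.log 2 := Real.log_pos one_lt_two
  have hnn : ∀ k, 0 ≤ denTime q (k + 1) - denTime q k := fun k =>
    sub_nonneg.2 (h.denTime_mono k.le_succ)
  induction N using Nat.twoStepInduction with
  | zero => simpa using hlog.le
  | one =>
    simpa using ⟨by simpa using hnn 0, by linarith⟩
  | more N ih _ =>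
    rw [Finset.sum_range_succ, Finset.sum_range_succ]
    have h2 := h.two_log_two_le_denTime_sub N
    have h0 := hnn N
    have h1 := hnn (N + 1)
    push_cast
    rcases min_cases (denTime q (N + 1) - denTime q N) M with ⟨e, -⟩ | ⟨e, -⟩ <;>
      rcases min_cases (denTime q (N + 1 + 1) - denTime q (N + 1)) M with ⟨e', -⟩ | ⟨e', -⟩ <;>
      rw [e, e'] <;> linarith

theorem sub_one_mul_log_two_le (h : ConvergentData x a p q) (N : ℕ) :
    (N - 1) * Real.log 2 ≤ denTime q N := by
  refine (h.le_sum_min le_rfl N).trans ?_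
  rw [← h.sum_denTime_sub N]
  exact Finset.sum_le_sum fun k _ => min_le_left _ _

theorem tendsto_denTime (h : ConvergentData x a p q) : Tendsto (denTime q) atTop atTop := by
  refine tendsto_atTop_mono h.sub_one_mul_log_two_le ?_
  exact (tendsto_atTop_add_const_right _ _ tendsto_natCast_atTop_atTop).atTop_mul_const
    (Real.log_pos one_lt_two)

/-- Since max(ℓ - c, 0) + min(ℓ, c) = ℓ, the upper bound for the visit time is a lower bound for the
time outside. -/
theorem visitTime_add_sum_min_le (h : ConvergentData x a p q) {ε : ℝ} (hε0 : 0 < ε)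
    (hε : ε ≤ 1 / 2) (N : ℕ) :
    visitTime x (shortVectorSet ε) (denTime q N) + ∑ k ∈ Finset.range N,
      min (denTime q (k + 1) - denTime q k) (-4 * Real.log ε - 2 * Real.log 2) ≤ denTime q N := by
  refine (add_le_add_left (h.visitTime_denTime_le hε0 hε N) _).trans_eq ?_
  rw [← Finset.sum_add_distrib, ← h.sum_denTime_sub N]
  refine Finset.sum_congr rfl fun k _ => ?_
  rcases le_total (denTime q (k + 1) - denTime q k) (-4 * Real.log ε - 2 * Real.log 2) with h1 | h1
  · rw [max_eq_right (by linarith), min_eq_left h1, zero_add]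
  · rw [max_eq_left (by linarith), min_eq_right h1, sub_add_cancel]

theorem denTime_le_visitTime_add (h : ConvergentData x a p q) {ε : ℝ} (hε0 : 0 < ε)
    (hε : ε ≤ 1 / 2) (N : ℕ) :
    denTime q N ≤ visitTime x (shortVectorSet ε) (denTime q N) + N * (-4 * Real.log ε) := by
  refine le_trans ?_ (add_le_add_left (h.le_visitTime_denTime hε0 hε N) _)
  have : (N : ℝ) * (-4 * Real.log ε) = ∑ k ∈ Finset.range N, -4 * Real.log ε := by simp
  rw [this, ← Finset.sum_add_distrib, ← h.sum_denTime_sub N]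
  exact Finset.sum_le_sum fun k _ => by
    linarith [le_max_left (denTime q (k + 1) - denTime q k - -4 * Real.log ε) 0]

theorem tendsto_visitProportion_one (h : ConvergentData x a p q)
    (hlim : Tendsto (fun N : ℕ => denTime q N / N) atTop atTop) {ε : ℝ} (hε0 : 0 < ε)
    (hε : ε ≤ 1 / 2) : Tendsto (visitProportion x (shortVectorSet ε)) atTop (𝓝 1) := by
  set C := -4 * Real.log ε with hC
  have hC0 : 0 ≤ C := by
    have := Real.log_nonpos hε0.le (by linarith : ε ≤ 1)
    linarith
  suffices hz : Tendsto (fun T => 1 - visitProportion x (shortVectorSet ε) T) atTop (𝓝 0) by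
    simpa using (tendsto_const_nhds (x := (1 : ℝ))).sub hz
  refine tendsto_zero_of_le_on_blocks (g := fun N => 2 * C * (denTime q N / N)⁻¹)
    h.tendsto_denTime ?_ ?_ ?_
  · filter_upwards [eventually_gt_atTop 0] with T hT
    linarith [visitProportion_le_one x (shortVectorSet ε) hT]
  · simpa using hlim.inv_tendsto_atTop.const_mul (2 * C)
  · filter_upwards [h.tendsto_denTime.eventually_gt_atTop 0, eventually_ge_atTop 1]
      with N hN hN1 T h1 h2
    have hT : 0 < T := hN.trans_le h1
    have e1 := visitTime_le_add x (shortVectorSet ε) h2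
    have e2 := h.denTime_le_visitTime_add hε0 hε (N + 1)
    have hN1' : (1 : ℝ) ≤ N := by exact_mod_cast hN1
    -- The time outside is nondecreasing in T, so it is at most its value (N + 1)C at the end of the
    -- block.
    have e3 : T - visitTime x (shortVectorSet ε) T ≤ 2 * C * N := by
      push_cast at e2
      nlinarith
    rw [visitProportion_eq, one_sub_div hT.ne', inv_div]
    calc (T - visitTime x (shortVectorSet ε) T) / T ≤ 2 * C * N / T := by gcongr
      _ ≤ 2 * C * N / denTime q N := by gcongr
      _ = 2 * C * (N / denTime q N) := by ring

/-- One neighbourhood is enough: at ε = 1/2 the truncation level 4 log 2 - 2 log 2 is exactly the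
least one allowed in `le_sum_min`, so N / τ_N is at most (2 / log 2) times the proportion of time
outside. -/
theorem tendsto_denTime_div (h : ConvergentData x a p q)
    (hlim : Tendsto (visitProportion x (shortVectorSet (1 / 2))) atTop (𝓝 1)) :
    Tendsto (fun N : ℕ => denTime q N / N) atTop atTop := by
  have hlog : 0 < Real.log 2 := Real.log_pos one_lt_two
  have h1 := (hlim.comp h.tendsto_denTime).const_sub 1
  have h2 := h1.const_mul (2 / Real.log 2)
  rw [sub_self, mul_zero] at h2
  have h3 : Tendsto (fun N : ℕ => N / denTime q N) atTop (𝓝[>] 0) := by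
    refine tendsto_nhdsWithin_iff.2 ⟨?_, ?_⟩
    · refine tendsto_of_tendsto_of_tendsto_of_le_of_le' tendsto_const_nhds h2 ?_ ?_
      · exact Eventually.of_forall fun N => div_nonneg N.cast_nonneg (h.denTime_nonneg N)
      · filter_upwards [h.tendsto_denTime.eventually_gt_atTop 0, eventually_ge_atTop 2]
          with N hN hN2
        have hN2' : (2 : ℝ) ≤ N := by exact_mod_cast hN2
        have e1 := h.visitTime_add_sum_min_le (ε := 1 / 2) (by norm_num) le_rfl N
        have e2 := h.le_sum_min (M := -4 * Real.log (1 / 2) - 2 * Real.log 2)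
          (by rw [one_div, Real.log_inv]; linarith) N
        simp only [Function.comp_apply]
        rw [visitProportion_eq, one_sub_div hN.ne', ← mul_div_assoc]
        gcongr
        rw [div_mul_eq_mul_div, le_div_iff₀ hlog]
        nlinarith
    · filter_upwards [h.tendsto_denTime.eventually_gt_atTop 0, eventually_gt_atTop 0] with N hN hN0
      exact div_pos (by exact_mod_cast hN0) hN
  refine h3.inv_tendsto_nhdsGT_zero.congr fun N => ?_
  simp

theorem tendsto_logAverage_iff (h : ConvergentData x (partialQuotient x) p q) :
    Tendsto (logAverage x) atTop atTop ↔ Tendsto (fun N : ℕ => denTime q N / N) atTop atTop := by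
  have hlow : ∀ᶠ N : ℕ in atTop, 2 * logAverage x N ≤ denTime q N / N := by
    filter_upwards [eventually_gt_atTop 0] with N hN
    have hN' : (0 : ℝ) < N := by exact_mod_cast hN
    rw [le_div_iff₀ hN', mul_assoc, mul_comm (logAverage x N), natCast_mul_logAverage,
      Finset.mul_sum, ← h.sum_denTime_sub N]
    exact Finset.sum_le_sum fun k _ => h.two_log_le_denTime_sub k
  have hup : ∀ᶠ N : ℕ in atTop, denTime q N / N ≤ 2 * (logAverage x N + Real.log 2) := by
    filter_upwards [eventually_gt_atTop 0] with N hN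
    have hN' : (0 : ℝ) < N := by exact_mod_cast hN
    have e : 2 * (logAverage x N + Real.log 2) * N =
        ∑ k ∈ Finset.range N, 2 * (Real.log (partialQuotient x (k + 1)) + Real.log 2) := by
      rw [← Finset.mul_sum, Finset.sum_add_distrib, ← natCast_mul_logAverage]
      simp
      ring
    rw [div_le_iff₀ hN', e, ← h.sum_denTime_sub N]
    exact Finset.sum_le_sum fun k _ =>
      (h.denTime_sub_le_two_log k).trans (by linarith [log_add_one_le (h.one_le_a k)])
  constructor
  · exact fun ht => tendsto_atTop_mono' _ hlow (ht.const_mul_atTop two_pos)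
  · intro ht
    have h1 := tendsto_atTop_mono' _ hup ht
    have h2 := tendsto_atTop_add_const_right _ (-Real.log 2)
      (h1.const_mul_atTop (one_half_pos (α := ℝ)))
    refine h2.congr fun N => ?_
    ring

theorem log_modifiedPartialQuotient_nonneg (h : ConvergentData x (partialQuotient x) p q) (ξ : ℝ)
    (k : ℕ) : 0 ≤ Real.log (modifiedPartialQuotient x ξ (k + 1)) := by
  unfold modifiedPartialQuotient
  split_ifs
  · exact Real.log_nonneg (h.one_le_a k)
  · simp

/-- With ε = 1/(2(ξ + 1)) the time lost per block is at least 4 log(ξ + 1) + 2 log 2. A block with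
a_{k+1} ≤ ξ is no longer than 2 log(ξ + 1) and contributes nothing; any other contributes at most 2
log a_{k+1}. Linear growth of τ_N finishes the estimate. -/
theorem tendsto_visitProportion_zero (h : ConvergentData x (partialQuotient x) p q) {ξ : ℝ}
    (hξ : 1 < ξ) (hlim : Tendsto (modifiedLogAverage x ξ) atTop (𝓝 0)) :
    Tendsto (visitProportion x (shortVectorSet (1 / (2 * (ξ + 1))))) atTop (𝓝 0) := by
  have hlog : 0 < Real.log 2 := Real.log_pos one_lt_two
  have hε0 : 0 < 1 / (2 * (ξ + 1)) := by positivity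
  have hε : 1 / (2 * (ξ + 1)) ≤ 1 / 2 := one_div_le_one_div_of_le two_pos (by linarith)
  have hεlog : Real.log (1 / (2 * (ξ + 1))) = -(Real.log 2 + Real.log (ξ + 1)) := by
    rw [one_div, Real.log_inv, Real.log_mul two_ne_zero (by positivity)]
  have hξ0 : 0 ≤ Real.log (ξ + 1) := Real.log_nonneg (by linarith)
  set ε := 1 / (2 * (ξ + 1))
  have hV : ∀ N : ℕ, visitTime x (shortVectorSet ε) (denTime q N) ≤
      2 * (N * modifiedLogAverage x ξ N) := by
    intro N
    refine (h.visitTime_denTime_le hε0 hε N).trans ?_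
    rw [natCast_mul_modifiedLogAverage, Finset.mul_sum]
    refine Finset.sum_le_sum fun k _ => max_le ?_ ?_
    · have e1 := h.denTime_sub_le_two_log k
      rw [hεlog]
      unfold modifiedPartialQuotient
      split_ifs with hk
      · linarith [log_add_one_le (h.one_le_a k)]
      · have := Real.log_le_log (by linarith [h.one_le_a k])
          (add_le_add_left (not_lt.1 hk) 1)
        simp only [Real.log_one]
        linarith
    · exact mul_nonneg two_pos.le (h.log_modifiedPartialQuotient_nonneg ξ k)
  refine tendsto_zero_of_le_on_blocks
    (g := fun N => 4 / Real.log 2 * modifiedLogAverage x ξ (N + 1)) h.tendsto_denTime ?_ ?_ ?_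
  · filter_upwards [eventually_gt_atTop 0] with T hT
    exact div_nonneg (visitTime_nonneg _ _ _) hT.le
  · simpa using (hlim.comp (tendsto_add_atTop_nat 1)).const_mul (4 / Real.log 2)
  · filter_upwards [h.tendsto_denTime.eventually_gt_atTop 0, eventually_ge_atTop 3]
      with N hN hN3 T h1 h2
    have hN3' : (3 : ℝ) ≤ N := by exact_mod_cast hN3
    have hT : 0 < T := hN.trans_le h1
    have hA : 0 ≤ (N + 1 : ℕ) * modifiedLogAverage x ξ (N + 1) := by
      rw [natCast_mul_modifiedLogAverage]
      exact Finset.sum_nonneg fun k _ => h.log_modifiedPartialQuotient_nonneg ξ k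
    have hA' : 0 ≤ modifiedLogAverage x ξ (N + 1) :=
      nonneg_of_mul_nonneg_right hA (by positivity)
    have e1 := (visitTime_mono x (shortVectorSet ε) h2).trans (hV (N + 1))
    have e2 := h.sub_one_mul_log_two_le N
    rw [visitProportion_eq, div_le_iff₀ hT]
    refine e1.trans ?_
    -- For N ≥ 3, N + 1 ≤ 2(N - 1), and (N - 1) log 2 ≤ τ_N ≤ T.
    have e3 : ((N + 1 : ℕ) : ℝ) ≤ 2 / Real.log 2 * T := by
      rw [div_mul_eq_mul_div, le_div_iff₀ hlog]
      push_cast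
      nlinarith
    calc 2 * (((N + 1 : ℕ) : ℝ) * modifiedLogAverage x ξ (N + 1))
        ≤ 2 * (2 / Real.log 2 * T * modifiedLogAverage x ξ (N + 1)) := by gcongr
      _ = 4 / Real.log 2 * modifiedLogAverage x ξ (N + 1) * T := by ring

/-- The choice ξ = e^C = ε⁻⁴ makes a block with a_{k+1} > ξ contribute at least 2 log a_{k+1} - C ≥
log a_{k+1}. Since τ_N itself depends on A_N^ξ, that dependence has to be absorbed once the
proportion is small. -/
theorem tendsto_modifiedLogAverage (h : ConvergentData x (partialQuotient x) p q) {ε : ℝ}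
    (hε0 : 0 < ε) (hε : ε ≤ 1 / 2)
    (hlim : Tendsto (visitProportion x (shortVectorSet ε)) atTop (𝓝 0)) :
    Tendsto (modifiedLogAverage x (Real.exp (-4 * Real.log ε))) atTop (𝓝 0) := by
  set C := -4 * Real.log ε with hC
  set ξ := Real.exp C with hξ
  have hξ0 : 0 < ξ := Real.exp_pos _
  set D := 2 * Real.log (ξ + 1) + 2 * Real.log 2 with hD
  have hlog : 0 < Real.log 2 := Real.log_pos one_lt_two
  have hξ1 : 0 ≤ Real.log (ξ + 1) := Real.log_nonneg (by linarith)
  have hV : ∀ N : ℕ, N * modifiedLogAverage x ξ N ≤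
      visitTime x (shortVectorSet ε) (denTime q N) := by
    intro N
    refine le_trans ?_ (h.le_visitTime_denTime hε0 hε N)
    rw [natCast_mul_modifiedLogAverage]
    refine Finset.sum_le_sum fun k _ => ?_
    unfold modifiedPartialQuotient
    split_ifs with hk
    · refine le_max_of_le_left ?_
      have e1 := h.two_log_le_denTime_sub k
      have e2 : C ≤ Real.log (partialQuotient x (k + 1)) :=
        (Real.le_log_iff_exp_le (hξ0.trans hk)).2 hk.le
      linarith
    · simp
  have hl : ∀ N : ℕ, denTime q N ≤ 2 * (N * modifiedLogAverage x ξ N) + N * D := by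
    intro N
    have e : (N : ℝ) * D = ∑ k ∈ Finset.range N, D := by simp
    rw [natCast_mul_modifiedLogAverage, Finset.mul_sum, e, ← Finset.sum_add_distrib,
      ← h.sum_denTime_sub N]
    refine Finset.sum_le_sum fun k _ => (h.denTime_sub_le_two_log k).trans ?_
    unfold modifiedPartialQuotient
    split_ifs with hk
    · linarith [log_add_one_le (h.one_le_a k)]
    · have := Real.log_le_log (by linarith [h.one_le_a k]) (add_le_add_left (not_lt.1 hk) 1)
      simp only [Real.log_one]
      linarith
  have hr := hlim.comp h.tendsto_denTime
  have hr2 := hr.const_mul (2 * D)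
  rw [mul_zero] at hr2
  refine tendsto_of_tendsto_of_tendsto_of_le_of_le' tendsto_const_nhds hr2 ?_ ?_
  · filter_upwards [eventually_gt_atTop 0] with N hN
    have hN' : (0 : ℝ) < N := by exact_mod_cast hN
    refine nonneg_of_mul_nonneg_right ?_ hN'
    rw [natCast_mul_modifiedLogAverage]
    exact Finset.sum_nonneg fun k _ => h.log_modifiedPartialQuotient_nonneg ξ k
  · filter_upwards [eventually_gt_atTop 0, h.tendsto_denTime.eventually_gt_atTop 0,
      hr.eventually_lt_const (show (0 : ℝ) < 1 / 4 by norm_num)] with N hN hN0 hN1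
    have hN' : (0 : ℝ) < N := by exact_mod_cast hN
    simp only [Function.comp_apply] at hN1 ⊢
    set r := visitProportion x (shortVectorSet ε) (denTime q N) with hrdef
    have hr0 : 0 ≤ r := div_nonneg (visitTime_nonneg _ _ _) hN0.le
    have e1 : visitTime x (shortVectorSet ε) (denTime q N) = r * denTime q N := by
      rw [hrdef, visitProportion_eq]; field_simp
    have e2 := hV N
    have e3 := mul_le_mul_of_nonneg_left (hl N) hr0
    have e4 : 0 ≤ N * modifiedLogAverage x ξ N := by
      rw [natCast_mul_modifiedLogAverage]
      exact Finset.sum_nonneg fun k _ => h.log_modifiedPartialQuotient_nonneg ξ k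
    have e5 : r * (N * modifiedLogAverage x ξ N) ≤ 1 / 4 * (N * modifiedLogAverage x ξ N) := by
      gcongr
    refine le_of_mul_le_mul_left ?_ hN'
    -- With A = A_N^ξ, N A ≤ r τ_N ≤ r(2 N A + N D), and r < 1/4 lets half of N A be absorbed: A ≤ 2
    -- D r.
    nlinarith

end ConvergentData

/-! ### Rational x and the conclusion. -/

theorem visitsCuspWithFrequencyOne_of_rat (r : ℚ) : VisitsCuspWithFrequencyOne r := by
  rw [visitsCuspWithFrequencyOne_iff]
  intro ε hε0 _
  -- After this time the vector (denominator, -numerator), whose second coordinate is 0, stays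
  -- shorter than ε.
  set s : ℝ := max 0 (2 * Real.log (r.den / ε)) with hs
  have hden : (0 : ℝ) < r.den := by exact_mod_cast r.den_pos
  have hmem : ∀ t, s < t → cuspOrbit r t ∈ shortVectorSet ε := by
    intro t ht
    rw [cuspOrbit_mem_shortVectorSet]
    refine ⟨r.den, -r.num, Or.inl (by exact_mod_cast r.den_ne_zero), ?_, ?_⟩
    · have h1 : Real.log (r.den / ε) < t / 2 := by
        linarith [le_max_right 0 (2 * Real.log (r.den / ε))]
      rw [Real.log_lt_iff_lt_exp (by positivity), div_lt_iff₀ hε0] at h1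
      have e : Real.exp (-t / 2) = (Real.exp (t / 2))⁻¹ := by
        rw [← Real.exp_neg]; congr 1; ring
      rw [e, mul_inv_lt_iff₀ (Real.exp_pos _)]
      simpa [mul_comm] using h1
    · have : ((r.den : ℤ) : ℝ) * (r : ℝ) + ((-r.num : ℤ) : ℝ) = 0 := by
        have := Rat.den_mul_eq_num r
        have h2 : ((r.den : ℚ) : ℝ) * (r : ℝ) = ((r.num : ℚ) : ℝ) := by exact_mod_cast this
        push_cast at h2 ⊢
        linarith
      rw [this]
      simpa using hε0
  have hlow : Tendsto (fun T : ℝ => 1 - s / T) atTop (𝓝 1) := by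
    simpa using (tendsto_const_nhds (x := (1 : ℝ))).sub (tendsto_const_nhds.div_atTop tendsto_id)
  refine tendsto_of_tendsto_of_tendsto_of_le_of_le' hlow tendsto_const_nhds ?_ ?_
  · filter_upwards [eventually_gt_atTop 0, eventually_ge_atTop s] with T hT hsT
    rw [visitProportion_eq, one_sub_div hT.ne']
    have h1 : volume.real (Set.Ioc s T) ≤ visitTime r (shortVectorSet ε) T :=
      measureReal_mono (fun t ht => ⟨⟨(le_max_left _ _).trans ht.1.le, ht.2⟩, hmem t ht.1⟩)
        (volume_visits_ne_top _ _ _)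
    have h2 : volume.real (Set.Ioc s T) = T - s := by simp [hsT]
    rw [h2] at h1
    gcongr
  · filter_upwards [eventually_gt_atTop 0] with T hT
    exact visitProportion_le_one _ _ hT

theorem VisitsCuspWithFrequencyOne.not_frequencyZero {x : ℝ} (h : VisitsCuspWithFrequencyOne x) :
    ¬ VisitsCuspWithFrequencyZero x := by
  rintro ⟨U, hU, h0⟩
  exact zero_ne_one (tendsto_nhds_unique h0 (h U hU))

/-- For irrational `x` the expansion is infinite and the two equivalences hold. For rational `x`
the expansion is finite (`a_j = ∞` from some `j` on, so that the averages become infinite): the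
orbit visits the cusp with frequency one and not with frequency zero. -/
theorem theorem1p2 (x : ℝ) :
    (Irrational x →
      (VisitsCuspWithFrequencyZero x ↔
        ∃ ξ : ℝ, 1 < ξ ∧ Tendsto (modifiedLogAverage x ξ) atTop (𝓝 0)) ∧
      (VisitsCuspWithFrequencyOne x ↔ Tendsto (logAverage x) atTop atTop)) ∧
    (¬ Irrational x →
      VisitsCuspWithFrequencyOne x ∧ ¬ VisitsCuspWithFrequencyZero x) := by
  refine ⟨fun hx => ?_, fun hx => ?_⟩
  · obtain ⟨p, q, h⟩ := exists_convergentData hx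
    refine ⟨?_, ?_⟩
    · rw [visitsCuspWithFrequencyZero_iff]
      constructor
      · rintro ⟨ε, hε0, hε, hlim⟩
        have hlog := Real.log_neg hε0 (by linarith)
        exact ⟨_, Real.one_lt_exp_iff.2 (by linarith), h.tendsto_modifiedLogAverage hε0 hε hlim⟩
      · rintro ⟨ξ, hξ, hlim⟩
        exact ⟨_, by positivity, one_div_le_one_div_of_le two_pos (by linarith),
          h.tendsto_visitProportion_zero hξ hlim⟩
    · rw [visitsCuspWithFrequencyOne_iff, h.tendsto_logAverage_iff]
      exact ⟨fun H => h.tendsto_denTime_div (H _ (by norm_num) le_rfl),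
        fun H ε hε0 hε => h.tendsto_visitProportion_one H hε0 hε⟩
  · obtain ⟨r, rfl⟩ := not_not.1 hx
    have := visitsCuspWithFrequencyOne_of_rat r
    exact ⟨this, this.not_frequencyZero⟩
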